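/- Let $\Gamma$ be a finite group and let $U$ be an irreducible finite-dimensional real representation of $\Gamma$. Let $D$ be a real algebra with $D \cong \mathrm{End}_\Gamma(U)$ (by the theorems of Schur and Frobenius, $D$ is one of $\mathbb{R}, \mathbb{C}, \mathbb{H}$ up to isomorphism), regard $U$ as a left $D$-module through this isomorphism, and let $\dim_D U = \dim_{\mathbb{R}} U / \dim_{\mathbb{R}} D$ be its rank. Let $X$ be a finite-dimensional real representation of $\Gamma$ isomorphic to $U \otimes \mathbb{R}^m$, where $\Gamma$ acts trivially on $\mathbb{R}^m$ (that is, $X$ consists of $m \ge 0$ copies of $U$). Let $Q_1, \ldots, Q_s : X \to \mathbb{R}$ be $\Gamma$-invariant quadratic forms, i.e. $Q_i(g x) = Q_i(x)$ for all $g \in \Gamma$, $x \in X$. If $m \le \dim_D U$, then the image $\{(Q_1(x), \ldots, Q_s(x)) : x \in X\} \subseteq \mathbb{R}^s$ is convex. -/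

import Mathlib

open scoped TensorProduct

namespace Representation

variable {Γ U : Type*} [Monoid Γ] [AddCommGroup U] [Module ℝ U]

/-- The tautological action of the ring `End_Γ(U)` on `U`, as a ring homomorphism into the additive
endomorphisms of `U`: `f` acts by `u ↦ f u`. -/
def endAction (ρ : Representation ℝ Γ U) : ρ.IntertwiningMap ρ →+* AddMonoid.End U where
  toFun f := f.toLinearMap.toAddMonoidHom
  map_one' := rfl
  map_mul' _ _ := rfl
  map_zero' := rfl
  map_add' _ _ := rfl

/-- An isomorphism `e : D ≅ End_Γ(U)` makes `U` a left `D`-module, by `a • u = e a u`. -/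
abbrev moduleOfEndEquiv (ρ : Representation ℝ Γ U) {D : Type*} [Ring D] [Algebra ℝ D]
    (e : D ≃ₐ[ℝ] ρ.IntertwiningMap ρ) : Module D U :=
  Module.compHom U (ρ.endAction.comp (e : D →+* ρ.IntertwiningMap ρ))

/-- `dim_D U`: the rank of `U` as a left `D`-module, the module structure being the one given by
the isomorphism `e : D ≅ End_Γ(U)`. -/
noncomputable def dimOver (ρ : Representation ℝ Γ U) {D : Type*} [Ring D] [Algebra ℝ D]
    (e : D ≃ₐ[ℝ] ρ.IntertwiningMap ρ) : ℕ :=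
  letI : Module D U := ρ.moduleOfEndEquiv e
  Module.finrank D U

end Representation

/-! Average an inner product so that `Γ` acts orthogonally on `U`, and write `x ∈ X` as a tuple `u`
of `m` vectors of `U`. By Riesz, every invariant form is a sum of terms `⟪u i, f (u j)⟫` with `f ∈
End_Γ(U)`, so it is linear in this `D`-valued Gram data, and it suffices that the Gram data of
`m`-tuples form a convex set. A convex combination of two Gram matrices is the Gram matrix of a
tuple in `U ⊕ U` (`exists_gram_eq_add`). When `m ≤ dim_D U`, Gram-Schmidt over `D` realises it in
`U` (`exists_gram_eq`). Schur's lemma makes symmetric intertwiners scalar, so only the length of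
each new orthogonal component matters; the classification of `D` is not needed. -/

open scoped InnerProductSpace

/-! ### Gram matrices over `D` -/

section Gram

variable {D U V : Type*} [Ring D] [Algebra ℝ D]
  [NormedAddCommGroup U] [InnerProductSpace ℝ U] [FiniteDimensional ℝ U]
  [NormedAddCommGroup V] [InnerProductSpace ℝ V] [FiniteDimensional ℝ V]
  [Module D U] [IsScalarTower ℝ D U] [Module D V] [IsScalarTower ℝ D V]

/-- The `D`-valued Gram matrix of a tuple of `k ≤ dim_D U` vectors of `V` is also the Gram matrix
of a tuple in `U`, when `D` acts on `U` and `V` compatibly with an adjoint and the quadratic form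
of every operator in `D` is a multiple of the squared norm. -/
theorem exists_gram_eq [StrongRankCondition D] (adj : D → D) (c : D → ℝ)
    (hU : ∀ (a : D) (u v : U), ⟪a • u, v⟫_ℝ = ⟪u, adj a • v⟫_ℝ)
    (hV : ∀ (a : D) (u v : V), ⟪a • u, v⟫_ℝ = ⟪u, adj a • v⟫_ℝ)
    (hcU : ∀ (a : D) (u : U), ⟪u, a • u⟫_ℝ = c a * ⟪u, u⟫_ℝ)
    (hcV : ∀ (a : D) (u : V), ⟪u, a • u⟫_ℝ = c a * ⟪u, u⟫_ℝ)
    (k : ℕ) (hk : k ≤ Module.finrank D U) (w : Fin k → V) :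
    ∃ z : Fin k → U, ∀ (a : D) (i j : Fin k), ⟪z i, a • z j⟫_ℝ = ⟪w i, a • w j⟫_ℝ := by
  induction k with
  | zero => exact ⟨0, fun _ i => i.elim0⟩
  | succ k ih =>
    obtain ⟨z, hz⟩ := ih (by omega) (fun i => w i.castSucc)
    set w' : Fin k → V := fun i => w i.castSucc with hw'
    set x := w (Fin.last k)
    let M : Submodule ℝ V := (Submodule.span D (Set.range w')).restrictScalars ℝ
    let N : Submodule ℝ U := (Submodule.span D (Set.range z)).restrictScalars ℝ
    obtain ⟨p, hp, r, hr, hx⟩ := M.exists_add_mem_mem_orthogonal x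
    have hrM : ∀ v ∈ Submodule.span D (Set.range w'), ⟪v, r⟫_ℝ = 0 :=
      fun v hv => (M.mem_orthogonal r).1 hr v hv
    obtain ⟨b, hb⟩ := (Submodule.mem_span_range_iff_exists_fun D).1
      (show p ∈ Submodule.span D (Set.range w') from hp)
    -- The `k` vectors `z i` cannot span `U` over `D`, since `k + 1 ≤ dim_D U`.
    have hN : Nᗮ ≠ ⊥ := by
      intro h
      have h1 : N = ⊤ := (Submodule.orthogonal_eq_bot_iff).1 h
      have h2 : Submodule.span D (Set.range z) = ⊤ :=
        (Submodule.restrictScalars_eq_top_iff ℝ D U).1 h1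
      have h3 := finrank_range_le_card (R := D) z
      rw [Set.finrank, h2, finrank_top, Fintype.card_fin] at h3
      omega
    obtain ⟨u, hu, hu0⟩ := Submodule.exists_mem_ne_zero_of_ne_bot hN
    -- Matching lengths suffices: by `hcU` and `hcV` they determine `⟪q, a • q⟫` and `⟪r, a • r⟫`
    -- for all `a`.
    obtain ⟨q, hq, hqr⟩ : ∃ q ∈ Nᗮ, ⟪q, q⟫_ℝ = ⟪r, r⟫_ℝ := by
      refine ⟨(‖r‖ / ‖u‖) • u, Submodule.smul_mem _ _ hu, ?_⟩
      have : ‖u‖ ≠ 0 := norm_ne_zero_iff.2 hu0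
      rw [real_inner_self_eq_norm_sq, real_inner_self_eq_norm_sq, norm_smul, norm_div,
        norm_norm, norm_norm, div_mul_cancel₀ _ this]
    have hqN : ∀ v ∈ Submodule.span D (Set.range z), ⟪v, q⟫_ℝ = 0 :=
      fun v hv => (N.mem_orthogonal q).1 hq v hv
    -- The coefficients of `p` are reused, so `p'` has the same products with the `z i` as `p` with
    -- the `w' i`.
    set p' := ∑ i, b i • z i with hp'
    have hp'N : p' ∈ Submodule.span D (Set.range z) :=
      (Submodule.mem_span_range_iff_exists_fun D).2 ⟨b, rfl⟩
    have key1 : ∀ (a : D) (i : Fin k), ⟪z i, a • p'⟫_ℝ = ⟪w' i, a • p⟫_ℝ := by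
      intro a i
      simp only [hp', ← hb, Finset.smul_sum, inner_sum, smul_smul, hz, hw']
    have key2 : ∀ a : D, ⟪p', a • p'⟫_ℝ = ⟪p, a • p⟫_ℝ := by
      intro a
      conv_lhs => rw [hp', sum_inner]
      conv_rhs => rw [← hb, sum_inner]
      refine Finset.sum_congr rfl fun i _ => ?_
      rw [hU, hV, smul_smul, smul_smul, ← hp', key1, hb]
    have col : ∀ (a : D) (i : Fin k), ⟪z i, a • (p' + q)⟫_ℝ = ⟪w' i, a • x⟫_ℝ := by
      intro a i
      have h1 : ⟪z i, a • q⟫_ℝ = 0 := by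
        rw [real_inner_comm, hU, real_inner_comm]
        exact hqN _ (Submodule.smul_mem _ _ (Submodule.subset_span ⟨i, rfl⟩))
      have h2 : ⟪w' i, a • r⟫_ℝ = 0 := by
        rw [real_inner_comm, hV, real_inner_comm]
        exact hrM _ (Submodule.smul_mem _ _ (Submodule.subset_span ⟨i, rfl⟩))
      rw [hx, smul_add, smul_add, inner_add_right, inner_add_right, key1, h1, h2]
    have diag : ∀ a : D, ⟪p' + q, a • (p' + q)⟫_ℝ = ⟪x, a • x⟫_ℝ := by
      intro a
      have h1 : ⟪p', a • q⟫_ℝ = 0 := by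
        rw [real_inner_comm, hU, real_inner_comm]
        exact hqN _ (Submodule.smul_mem _ _ hp'N)
      have h2 : ⟪p, a • r⟫_ℝ = 0 := by
        rw [real_inner_comm, hV, real_inner_comm]
        exact hrM _ (Submodule.smul_mem _ _ hp)
      have h3 : ⟪q, a • p'⟫_ℝ = 0 := by
        rw [real_inner_comm]
        exact hqN _ (Submodule.smul_mem _ _ hp'N)
      have h4 : ⟪r, a • p⟫_ℝ = 0 := by
        rw [real_inner_comm]
        exact hrM _ (Submodule.smul_mem _ _ hp)
      rw [hx]
      simp only [smul_add, inner_add_left, inner_add_right, key2, h1, h2, h3, h4, hcU, hcV, hqr]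
    refine ⟨Fin.snoc z (p' + q), fun a i j => ?_⟩
    induction i using Fin.lastCases with
    | last =>
      induction j using Fin.lastCases with
      | last => simpa using diag a
      | cast j =>
        simp only [Fin.snoc_last, Fin.snoc_castSucc]
        rw [real_inner_comm, hU, col, ← hV, real_inner_comm]
    | cast i =>
      induction j using Fin.lastCases with
      | last => simpa using col a i
      | cast j => simpa using hz a i j

/-- Under the hypotheses of `exists_gram_eq`, Gram matrices of `k`-tuples in `U` with
`k ≤ dim_D U` are closed under nonnegative combinations. -/
theorem exists_gram_eq_add [StrongRankCondition D] (adj : D → D) (c : D → ℝ)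
    (hU : ∀ (a : D) (u v : U), ⟪a • u, v⟫_ℝ = ⟪u, adj a • v⟫_ℝ)
    (hcU : ∀ (a : D) (u : U), ⟪u, a • u⟫_ℝ = c a * ⟪u, u⟫_ℝ)
    (k : ℕ) (hk : k ≤ Module.finrank D U) (x y : Fin k → U) {s t : ℝ} (hs : 0 ≤ s) (ht : 0 ≤ t) :
    ∃ z : Fin k → U, ∀ (a : D) (i j : Fin k),
      ⟪z i, a • z j⟫_ℝ = s * ⟪x i, a • x j⟫_ℝ + t * ⟪y i, a • y j⟫_ℝ := by
  have : SMulCommClass ℝ D U := IsScalarTower.to_smulCommClass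
  -- Gram matrices add in an orthogonal direct sum; the square roots supply the weights `s` and `t`.
  obtain ⟨z, hz⟩ := exists_gram_eq (V := WithLp 2 (U × U)) adj c hU
    (fun a u v => by simp [WithLp.prod_inner_apply, hU]) hcU
    (fun a u => by
      simp only [WithLp.prod_inner_apply, WithLp.ofLp_smul, Prod.smul_fst, Prod.smul_snd, hcU,
        mul_add]) k hk
    (fun i => WithLp.toLp 2 (√s • x i, √t • y i))
  refine ⟨z, fun a i j => ?_⟩
  rw [hz]
  simp only [WithLp.prod_inner_apply, WithLp.ofLp_smul, Prod.smul_fst, Prod.smul_snd, smul_comm a, inner_smul_left,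
    inner_smul_right, RCLike.conj_to_real, ← mul_assoc, Real.mul_self_sqrt hs,
    Real.mul_self_sqrt ht]

end Gram

/-! ### Orthogonal representations and their invariant forms -/

namespace Representation

section Orthogonal

variable {Γ U : Type*} [Group Γ] [NormedAddCommGroup U] [InnerProductSpace ℝ U]
  {ρ : Representation ℝ Γ U}

theorem inner_apply_left (hρ : ∀ g u v, ⟪ρ g u, ρ g v⟫_ℝ = ⟪u, v⟫_ℝ) (g : Γ) (u v : U) :
    ⟪ρ g u, v⟫_ℝ = ⟪u, ρ g⁻¹ v⟫_ℝ := by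
  rw [← hρ g⁻¹, inv_self_apply]

/-- A linear map whose associated bilinear form is invariant under an orthogonal representation is
an intertwining map. -/
def intertwiningOfInvariant (hρ : ∀ g u v, ⟪ρ g u, ρ g v⟫_ℝ = ⟪u, v⟫_ℝ) (T : U →ₗ[ℝ] U)
    (hT : ∀ g u v, ⟪ρ g u, T (ρ g v)⟫_ℝ = ⟪u, T v⟫_ℝ) : ρ.IntertwiningMap ρ where
  toLinearMap := T
  isIntertwining' g := by
    ext v
    refine ext_inner_left ℝ fun u => ?_
    have := hT g (ρ g⁻¹ u) v
    rw [self_inv_apply] at this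
    simpa [inner_apply_left hρ] using this

theorem nontrivial_of_isIrreducible (hU : ρ.IsIrreducible) : Nontrivial U := by
  by_contra h
  rw [not_nontrivial_iff_subsingleton] at h
  obtain ⟨a, b, hab⟩ := hU.exists_pair_ne
  exact hab (Subrepresentation.toSubmodule_injective (Subsingleton.elim _ _))

variable [FiniteDimensional ℝ U]

/-- The adjoint of an endomorphism of an orthogonal representation. -/
noncomputable def intertwiningAdjoint (hρ : ∀ g u v, ⟪ρ g u, ρ g v⟫_ℝ = ⟪u, v⟫_ℝ)
    (f : ρ.IntertwiningMap ρ) : ρ.IntertwiningMap ρ :=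
  intertwiningOfInvariant hρ (LinearMap.adjoint f.toLinearMap) fun g u v => by
    rw [LinearMap.adjoint_inner_right, LinearMap.adjoint_inner_right, f.toLinearMap_apply,
      f.toLinearMap_apply, f.isIntertwining, hρ]

theorem inner_apply_intertwiningAdjoint (hρ : ∀ g u v, ⟪ρ g u, ρ g v⟫_ℝ = ⟪u, v⟫_ℝ)
    (f : ρ.IntertwiningMap ρ) (u v : U) :
    ⟪f u, v⟫_ℝ = ⟪u, intertwiningAdjoint hρ f v⟫_ℝ :=
  (LinearMap.adjoint_inner_right f.toLinearMap u v).symm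

/-- Symmetric endomorphisms of an irreducible orthogonal representation are scalars. -/
theorem exists_eq_smul_of_isSymmetric (hU : ρ.IsIrreducible) (f : ρ.IntertwiningMap ρ)
    (hf : f.toLinearMap.IsSymmetric) : ∃ μ : ℝ, ∀ u, f u = μ • u := by
  have := nontrivial_of_isIrreducible hU
  obtain ⟨μ, hμ⟩ : ∃ μ : ℝ, Module.End.eigenspace f.toLinearMap μ ≠ ⊥ := by
    by_contra! h
    exact not_subsingleton U (hf.subsingleton_of_no_eigenvalue_finiteDimensional h)
  let E : Subrepresentation ρ :=
    { toSubmodule := Module.End.eigenspace f.toLinearMap μ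
      apply_mem_toSubmodule := fun g v hv => by
        rw [Module.End.mem_eigenspace_iff] at hv ⊢
        rw [f.toLinearMap_apply] at hv ⊢
        rw [f.isIntertwining, hv, map_smul] }
  rcases hU.eq_bot_or_eq_top E with h | h
  · exact absurd (congrArg Subrepresentation.toSubmodule h) hμ
  · refine ⟨μ, fun u => Module.End.mem_eigenspace_iff.1 ?_⟩
    have : E.toSubmodule = ⊤ := congrArg Subrepresentation.toSubmodule h
    change u ∈ E.toSubmodule
    rw [this]
    exact Submodule.mem_top

/-- The quadratic form of an endomorphism of an irreducible orthogonal representation is a multiple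
of the squared norm. -/
theorem exists_inner_self_apply_eq (hρ : ∀ g u v, ⟪ρ g u, ρ g v⟫_ℝ = ⟪u, v⟫_ℝ)
    (hU : ρ.IsIrreducible) (f : ρ.IntertwiningMap ρ) :
    ∃ μ : ℝ, ∀ u, ⟪u, f u⟫_ℝ = μ * ⟪u, u⟫_ℝ := by
  -- `f` and its adjoint have the same quadratic form, so it is half that of their symmetric sum,
  -- which is a scalar.
  obtain ⟨μ, hμ⟩ := exists_eq_smul_of_isSymmetric hU (f + intertwiningAdjoint hρ f) (by
    intro u v
    change ⟪f u + intertwiningAdjoint hρ f u, v⟫_ℝ = ⟪u, f v + intertwiningAdjoint hρ f v⟫_ℝ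
    have h := inner_apply_intertwiningAdjoint hρ f v u
    rw [real_inner_comm, real_inner_comm (intertwiningAdjoint hρ f u)] at h
    rw [inner_add_left, inner_add_right, inner_apply_intertwiningAdjoint, h, add_comm])
  refine ⟨μ / 2, fun u => ?_⟩
  have h := congrArg (fun v => ⟪u, v⟫_ℝ) (hμ u)
  change ⟪u, f u + intertwiningAdjoint hρ f u⟫_ℝ = ⟪u, μ • u⟫_ℝ at h
  rw [inner_add_right, ← inner_apply_intertwiningAdjoint, real_inner_comm u (f u),
    inner_smul_right] at h
  linarith

/-- Every invariant bilinear form on an orthogonal representation comes from an intertwining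
map. -/
theorem exists_intertwiningMap_of_invariant (hρ : ∀ g u v, ⟪ρ g u, ρ g v⟫_ℝ = ⟪u, v⟫_ℝ)
    (B : U →ₗ[ℝ] U →ₗ[ℝ] ℝ) (hB : ∀ g u v, B (ρ g u) (ρ g v) = B u v) :
    ∃ f : ρ.IntertwiningMap ρ, ∀ u v, B u v = ⟪u, f v⟫_ℝ := by
  let T : U →ₗ[ℝ] U := (InnerProductSpace.toDual ℝ U).symm.toLinearEquiv.toLinearMap ∘ₗ
    LinearMap.toContinuousLinearMap.toLinearMap ∘ₗ B.flip
  have hT : ∀ u v, ⟪u, T v⟫_ℝ = B u v := fun u v => by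
    rw [real_inner_comm]
    simp [T]
  exact ⟨intertwiningOfInvariant hρ T fun g u v => by rw [hT, hT, hB], fun u v => (hT u v).symm⟩

theorem exists_gram_add_of_le_dimOver {D : Type*} [Ring D] [Algebra ℝ D]
    (hρ : ∀ g u v, ⟪ρ g u, ρ g v⟫_ℝ = ⟪u, v⟫_ℝ)
    (hU : ρ.IsIrreducible) (e : D ≃ₐ[ℝ] ρ.IntertwiningMap ρ) {m : ℕ} (hm : m ≤ ρ.dimOver e)
    (x y : Fin m → U) {s t : ℝ} (hs : 0 ≤ s) (ht : 0 ≤ t) :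
    ∃ z : Fin m → U, ∀ (f : ρ.IntertwiningMap ρ) (i j : Fin m),
      ⟪z i, f (z j)⟫_ℝ = s * ⟪x i, f (x j)⟫_ℝ + t * ⟪y i, f (y j)⟫_ℝ := by
  let : Module D U := ρ.moduleOfEndEquiv e
  have smul_def : ∀ (a : D) (u : U), a • u = e a u := fun _ _ => rfl
  have : IsScalarTower ℝ D U := ⟨fun r a u => by
    rw [smul_def, smul_def, map_smul]
    rfl⟩
  have := nontrivial_of_isIrreducible hU
  have : Nontrivial D := by
    obtain ⟨u, hu⟩ := exists_ne (0 : U)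
    refine ⟨1, 0, fun h => hu ?_⟩
    rw [← one_smul D u, h, zero_smul]
  have : FiniteDimensional ℝ D := by
    let F : D →ₗ[ℝ] (U →ₗ[ℝ] U) :=
      { toFun := fun a => (e a).toLinearMap
        map_add' := fun a b => by rw [map_add]; rfl
        map_smul' := fun r a => by rw [map_smul]; rfl }
    exact FiniteDimensional.of_injective F fun a b h =>
      e.injective (IntertwiningMap.toLinearMap_injective ρ ρ h)
  -- A nontrivial Noetherian ring satisfies the strong rank condition.
  have : IsNoetherianRing D := isNoetherian_of_tower ℝ inferInstance
  choose c hc using exists_inner_self_apply_eq hρ hU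
  obtain ⟨z, hz⟩ := exists_gram_eq_add (fun a : D => e.symm (intertwiningAdjoint hρ (e a)))
    (fun a => c (e a))
    (fun a u v => by
      rw [smul_def, smul_def, e.apply_symm_apply, inner_apply_intertwiningAdjoint])
    (fun a u => hc (e a) u) m hm x y hs ht
  refine ⟨z, fun f i j => ?_⟩
  simpa only [smul_def, e.apply_symm_apply] using hz (e.symm f) i j

theorem convex_range_of_orthogonal {X D : Type*} [AddCommGroup X] [Module ℝ X]
    [Ring D] [Algebra ℝ D]
    (hρ : ∀ g u v, ⟪ρ g u, ρ g v⟫_ℝ = ⟪u, v⟫_ℝ)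
    (hU : ρ.IsIrreducible) (e : D ≃ₐ[ℝ] ρ.IntertwiningMap ρ) {m : ℕ} (hm : m ≤ ρ.dimOver e)
    (ρX : Representation ℝ Γ X)
    (φ : ρX.Equiv (ρ.tprod (Representation.trivial ℝ Γ (EuclideanSpace ℝ (Fin m)))))
    {ι : Type*} (Q : ι → QuadraticForm ℝ X) (hQ : ∀ i g x, Q i (ρX g x) = Q i x) :
    Convex ℝ (Set.range fun (x : X) (i : ι) => Q i x) := by
  let b := (EuclideanSpace.basisFun (Fin m) ℝ).toBasis
  let ψ : Fin m → U →ₗ[ℝ] X := fun i =>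
    φ.toLinearEquiv.symm.toLinearMap ∘ₗ (TensorProduct.mk ℝ U _).flip (b i)
  have hψ : ∀ i g u, ψ i (ρ g u) = ρX g (ψ i u) := fun i g u =>
    φ.symm.toIntertwiningMap.isIntertwining _ _ g (u ⊗ₜ b i)
  have hsurj : ∀ x : X, ∃ u : Fin m → U, x = ∑ i, ψ i (u i) := fun x => by
    obtain ⟨u, hu⟩ : ∃ u : Fin m → U, φ.toLinearEquiv x = ∑ i, u i ⊗ₜ[ℝ] b i := by
      induction φ.toLinearEquiv x with
      | zero => exact ⟨0, by simp⟩
      | tmul u v =>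
        refine ⟨fun i => b.repr v i • u, ?_⟩
        conv_lhs => rw [← b.sum_repr v]
        simp only [TensorProduct.tmul_sum, TensorProduct.tmul_smul, TensorProduct.smul_tmul']
      | add p q hp hq =>
        obtain ⟨u, hu⟩ := hp
        obtain ⟨v, hv⟩ := hq
        exact ⟨u + v, by simp [hu, hv, TensorProduct.add_tmul, Finset.sum_add_distrib]⟩
    refine ⟨u, φ.toLinearEquiv.injective ?_⟩
    rw [hu, map_sum]
    exact Finset.sum_congr rfl fun i _ => (φ.toLinearEquiv.apply_symm_apply _).symm
  -- Each block of the polar form of `Q k` is an invariant bilinear form on `U`.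
  have hB : ∀ k i j, ∃ f : ρ.IntertwiningMap ρ, ∀ u v,
      QuadraticMap.associated (Q k) (ψ i u) (ψ j v) = ⟪u, f v⟫_ℝ := fun k i j => by
    refine exists_intertwiningMap_of_invariant hρ
      ((QuadraticMap.associated (Q k)).compl₁₂ (ψ i) (ψ j)) fun g u v => ?_
    simp only [LinearMap.compl₁₂_apply, hψ, QuadraticMap.associated_apply, ← map_add, hQ]
  choose f hf using hB
  have hQf : ∀ k (u : Fin m → U), Q k (∑ i, ψ i (u i)) = ∑ i, ∑ j, ⟪u i, f k i j (u j)⟫_ℝ := by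
    intro k u
    rw [← QuadraticMap.associated_eq_self_apply ℝ (Q k)]
    simp only [map_sum, LinearMap.sum_apply, hf]
    exact Finset.sum_comm
  rintro _ ⟨x, rfl⟩ _ ⟨y, rfl⟩ s t hs ht -
  obtain ⟨x, rfl⟩ := hsurj x
  obtain ⟨y, rfl⟩ := hsurj y
  obtain ⟨z, hz⟩ := exists_gram_add_of_le_dimOver hρ hU e hm x y hs ht
  refine ⟨∑ i, ψ i (z i), funext fun k => ?_⟩
  simp only [Pi.add_apply, Pi.smul_apply, smul_eq_mul, hQf, hz, Finset.sum_add_distrib,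
    Finset.mul_sum]

end Orthogonal

/-- An invariant inner product for a representation of a finite group, obtained by averaging. -/
theorem exists_invariant_innerProductSpaceCore {Γ U : Type*} [Group Γ] [Finite Γ]
    [AddCommGroup U] [Module ℝ U] [FiniteDimensional ℝ U] (ρ : Representation ℝ Γ U) :
    ∃ c : InnerProductSpace.Core ℝ U,
      ∀ g u v, c.inner (ρ g u) (ρ g v) = c.inner u v := by
  classical
  have := Fintype.ofFinite Γ
  let F : U ≃ₗ[ℝ] EuclideanSpace ℝ (Fin (Module.finrank ℝ U)) :=
    LinearEquiv.ofFinrankEq _ _ (by simp)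
  refine ⟨{ inner := fun u v => ∑ g, ⟪F (ρ g u), F (ρ g v)⟫_ℝ
            conj_inner_symm := fun u v => ?_
            re_inner_nonneg := fun u => ?_
            add_left := fun u v w => ?_
            smul_left := fun u v r => ?_
            definite := fun u h => ?_ }, fun g u v => ?_⟩
  · simp [real_inner_comm]
  · exact Finset.sum_nonneg fun g _ => real_inner_self_nonneg
  · simp [inner_add_left, Finset.sum_add_distrib]
  · simp [inner_smul_left, Finset.mul_sum]
  · have := (Finset.sum_eq_zero_iff_of_nonneg fun g _ => real_inner_self_nonneg).1 h 1
      (Finset.mem_univ _)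
    simpa using this
  · refine Fintype.sum_equiv (Equiv.mulRight g) _ _ fun h => ?_
    simp [map_mul]

end Representation

theorem mainTheorem6 {Γ U X D : Type*} [Group Γ] [Finite Γ]
    [AddCommGroup U] [Module ℝ U] [FiniteDimensional ℝ U]
    [AddCommGroup X] [Module ℝ X] [FiniteDimensional ℝ X]
    [Ring D] [Algebra ℝ D]
    (ρU : Representation ℝ Γ U) (ρX : Representation ℝ Γ X)
    (hU : ρU.IsIrreducible)
    (e : D ≃ₐ[ℝ] ρU.IntertwiningMap ρU)
    (m : ℕ)
    (hX : Nonempty (ρX.Equiv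
      (ρU.tprod (Representation.trivial ℝ Γ (EuclideanSpace ℝ (Fin m))))))
    (hm : m ≤ ρU.dimOver e)
    (s : ℕ) (Q : Fin s → QuadraticForm ℝ X)
    (hQ : ∀ (i : Fin s) (g : Γ) (x : X), Q i (ρX g x) = Q i x) :
    Convex ℝ (Set.range fun (x : X) (i : Fin s) => Q i x) := by
  obtain ⟨c, hc⟩ := ρU.exists_invariant_innerProductSpaceCore
  obtain ⟨φ⟩ := hX
  let : NormedAddCommGroup U := c.toNormedAddCommGroup
  let : InnerProductSpace ℝ U := InnerProductSpace.ofCore c.toCore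
  exact Representation.convex_range_of_orthogonal (ρ := ρU) hc hU e hm ρX φ Q hQ
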